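/- Let $R$ be a (finite, reduced, crystallographic) root system in a rational vector space $\mathfrak h^*$, with a base of simple roots $\{\alpha_i\}_{i\in I}$, simple reflections $s_i$, Weyl group $W$, length function $\ell$ and Bruhat order $\le$. Recall the following notions. * A weight $\pi\in\mathfrak h^*$ is dominant integral if $\langle\pi,\alpha_i^\vee\rangle\in\mathbb Z_{\ge 0}$ for all $i\in I$; then $W_\pi=\mathrm{Stab}_W(\pi)$, $W^\pi$ is the set of $v\in W$ of minimal length in $vW_\pi$, and $[\mathrm{id},w]^\pi=\{v\in W^\pi : \mathrm{id}\le v\le w\}$. * For an integral weight $\pi$, an element $w\in W$ is $\pi$-minuscule if it has a reduced expression $w=s_{i_1}\cdots s_{i_\ell}$ with $\langle s_{i_{k+1}}\cdots s_{i_\ell}(\pi),\alpha_{i_k}^\vee\rangle=1$ for $1\le k\le \ell$. * The heap $H(w)$ of a reduced expression $w=s_{i_1}\cdots s_{i_\ell}$ is the set $\{p_1,\dots,p_\ell\}$ with the smallest partial order such that $p_j<p_k$ whenever $j<k$ and $s_{i_j}s_{i_k}\ne s_{i_k}s_{i_j}$, colored by $c(p_j)=i_j$. * For $D,D'\subseteq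 H(w)$, $D'$ is obtained from $D$ by an elementary excitation if there are $p<q$ in $H(w)$ with $p\in D'$, $q\in D$, $D\setminus\{q\}=D'\setminus\{p\}$, $c(p)=c(q)$, no $z$ with $p<z<q$ and $c(z)=c(p)$, and such that for every $u\in D\cap[p,q]$ the pair $(c(p),c(u))$ is not an edge of the Dynkin diagram. For $F\subseteq H(w)$, $\mathcal E_{H(w)}(F)$ is the set of all subsets obtained from $F$ by finitely many (possibly zero) elementary excitations. **Theorem.** Let $\pi$ be a dominant integral weight, let $w\in W$ be $\pi$-minuscule with a fixed reduced expression $w=s_{i_1}\cdots s_{i_\ell}$ and heap $H(w)$, and let $v\in[\mathrm{id},w]^\pi$. Then there is exactly one order filter (up-closed subset) $H(v)$ of $H(w)$ whose letters, read in the order in which they occur in $s_{i_1}\cdots s_{i_\ell}$, form a reduced expression of $v$; and the following are equivalent: (a) there are no nontrivial excited diagrams of $H(v)$ in $H(w)$, i.e. $|\mathcal E_{H(w)}(H(v))|=1$; (b) $wv^{-1}$ is $\pi'$-minuscule for some dominant integral weight $\pi'$. -/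

import Mathlib

namespace WeylHeap

noncomputable section

variable {ι M N : Type*} [AddCommGroup M] [Module ℚ M] [AddCommGroup N] [Module ℚ N]
  {P : RootPairing ι ℚ M N}

/-! ### Weyl group: words, length, Bruhat order -/

/-- The simple reflection `s_i` as an element of the Weyl group. -/
def simpleReflection (b : P.Base) (i : b.support) : P.weylGroup :=
  RootPairing.weylGroup.ofIdx P (i : ι)

/-- The product `s_{i_1} ⋯ s_{i_ℓ}` of a word `[i_1, …, i_ℓ]` in the nodes of the Dynkin diagram. -/
def wordProd (b : P.Base) (ω : List b.support) : P.weylGroup :=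
  (ω.map (simpleReflection b)).prod

/-- The Coxeter length: the least length of a word in the simple reflections with product `w`. -/
def length (b : P.Base) (w : P.weylGroup) : ℕ :=
  sInf {n : ℕ | ∃ ω : List b.support, ω.length = n ∧ wordProd b ω = w}

/-- `ω` is a reduced expression of `w`. -/
def IsReducedWord (b : P.Base) (ω : List b.support) (w : P.weylGroup) : Prop :=
  wordProd b ω = w ∧ ω.length = length b w

/-- The (strong) Bruhat order on the Weyl group: the reflexive transitive closure of
`u → s_β u` for roots `β` with `ℓ(u) < ℓ(s_β u)`. -/
def BruhatLE (b : P.Base) : P.weylGroup → P.weylGroup → Prop :=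
  Relation.ReflTransGen fun u x =>
    ∃ β : ι, x = RootPairing.weylGroup.ofIdx P β * u ∧ length b u < length b x

/-! ### Weights and minuscule elements -/

/-- `π` is a dominant integral weight: `⟨π, α_i^∨⟩` is a nonnegative integer for every simple
root `α_i`. -/
def IsDominantIntegral (b : P.Base) (π : M) : Prop :=
  ∀ i ∈ b.support, ∃ n : ℕ, P.toLinearMap π (P.coroot i) = n

/-- `w` is `π`-minuscule (in the sense of Peterson): there is a reduced expression
`w = s_{i_1} ⋯ s_{i_ℓ}` such that `⟨s_{i_{k+1}} ⋯ s_{i_ℓ}(π), α_{i_k}^∨⟩ = 1` for all `k`. -/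
def IsMinuscule (b : P.Base) (π : M) (w : P.weylGroup) : Prop :=
  ∃ ω : List b.support, IsReducedWord b ω w ∧
    ∀ k : Fin ω.length,
      P.toLinearMap (wordProd b (ω.drop (k + 1)) • π) (P.coroot (ω.get k)) = 1

/-- `v ∈ W^π`: `v` has minimal length in the coset `v W_π`, where `W_π` is the stabilizer
of `π`. -/
def IsMinCosetRep (b : P.Base) (π : M) (v : P.weylGroup) : Prop :=
  ∀ u ∈ MulAction.stabilizer P.weylGroup π, length b v ≤ length b (v * u)

/-- The interval `[u, w]^π = {x ∈ W^π : u ≤ x ≤ w}` in the Bruhat order. -/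
def bruhatInterval (b : P.Base) (π : M) (u w : P.weylGroup) : Set P.weylGroup :=
  {x | IsMinCosetRep b π x ∧ BruhatLE b u x ∧ BruhatLE b x w}

/-! ### Heaps -/

/-- The edges of the (unoriented) Dynkin diagram on the set of simple roots. -/
def DynkinAdj (b : P.Base) (i j : b.support) : Prop :=
  i ≠ j ∧ P.pairing i j ≠ 0

/-- The underlying set `{p_1, …, p_ℓ}` of the heap of a word of length `ℓ`. -/
def Heap (b : P.Base) (ω : List b.support) : Type := Fin ω.length

/-- The coloring `p_k ↦ i_k` of the heap. -/
def Heap.color {b : P.Base} {ω : List b.support} (p : Heap b ω) : b.support :=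
  ω.get p

/-- The generating relations `p_j < p_k` of the heap order: `j < k`, and `s_{i_j}`, `s_{i_k}` do not
commute. -/
def Heap.Gen {b : P.Base} {ω : List b.support} (p q : Heap b ω) : Prop :=
  (show Fin ω.length from p) < (show Fin ω.length from q) ∧
    simpleReflection b p.color * simpleReflection b q.color ≠
      simpleReflection b q.color * simpleReflection b p.color

theorem Heap.le_of_gen {b : P.Base} {ω : List b.support} {p q : Heap b ω}
    (h : Relation.ReflTransGen Heap.Gen p q) :
    (show Fin ω.length from p) ≤ (show Fin ω.length from q) := by
  induction h with
  | refl => exact le_rfl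
  | tail _ h ih => exact le_trans ih (le_of_lt h.1)

/-- The heap order: the smallest partial order containing the generating relations. -/
instance (b : P.Base) (ω : List b.support) : PartialOrder (Heap b ω) where
  le := Relation.ReflTransGen Heap.Gen
  le_refl _ := Relation.ReflTransGen.refl
  le_trans _ _ _ := Relation.ReflTransGen.trans
  le_antisymm p q h h' :=
    le_antisymm (α := Fin ω.length) (a := p) (b := q) (Heap.le_of_gen h) (Heap.le_of_gen h')

open Classical in
/-- The subword of `ω` formed by the letters at the positions in `F`. -/
def Heap.subword {b : P.Base} {ω : List b.support} (F : Set (Heap b ω)) : List b.support :=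
  ((List.finRange ω.length).filter fun k => k ∈ F).map ω.get

/-- `F` is the heap of `v` inside the heap of `ω`: an order filter whose letters, in the
order in which they occur in `ω`, form a reduced expression of `v`. -/
def Heap.IsHeapOf {b : P.Base} {ω : List b.support} (v : P.weylGroup) (F : Set (Heap b ω)) : Prop :=
  IsUpperSet F ∧ IsReducedWord b (Heap.subword F) v

/-! ### Excited diagrams of a colored poset -/

/-- Elementary excitation `D ▷ D'` in a poset `Q` with a coloring `c` by the vertices of a graph
with adjacency relation `adj`. -/
def ElementaryExcitation {Q I : Type*} [PartialOrder Q] (c : Q → I) (adj : I → I → Prop)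
    (D D' : Set Q) : Prop :=
  ∃ p q : Q, p < q ∧ p ∈ D' ∧ q ∈ D ∧ D \ {q} = D' \ {p} ∧ c p = c q ∧
    (∀ z, p < z → z < q → c z ≠ c p) ∧
    ∀ u ∈ D ∩ Set.Icc p q, ¬ adj (c p) (c u)

/-- The set of excited diagrams of `F`: everything reached from `F` by finitely many
elementary excitations. -/
def excitedDiagrams {Q I : Type*} [PartialOrder Q] (c : Q → I) (adj : I → I → Prop)
    (F : Set Q) : Set (Set Q) :=
  {D | Relation.ReflTransGen (ElementaryExcitation c adj) F D}

end

end WeylHeap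

namespace WeylHeap

open RootPairing

section

variable {ι M N : Type*} [AddCommGroup M] [Module ℚ M] [AddCommGroup N] [Module ℚ N]
  {P : RootPairing ι ℚ M N}

/-! ### The Weyl group action on roots and coroots -/

/-! Write n_i = ⟨π, α_i^∨⟩ and let A be the Cartan matrix. Along a minuscule word each letter
subtracts exactly its simple root, so being minuscule means n(c k) - ∑_{j>k} A(c j, c k) = 1 at
every position k (`MinusculeOn`). Subtracting these equations at two positions of the same color
gives -2 for the sum of A strictly between them (`MinusculeOn.sum_between`), with no weight left.
Hence equal colors are comparable in the heap, and a letter of a filter commutes with every later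
letter outside it.

Existence of H(v): v is the product of a subword of w. Its letters, applied to π from the right,
keep the weight of the form π - ∑_{k∈F} α_{c(k)} with F a filter, each letter adding or removing at
most one element (`exists_insert`, `exists_erase`). The element read off F and v then agree on π and
have no inversion orthogonal to π, so they are equal (`eq_of_smul_eq`). Uniqueness: the weight
determines the number of letters of each color, and a filter contains a final segment of each color.

Equivalence: w v⁻¹ is read off the complement of the filter. For these letters to be minuscule, the
new weight is forced by the last missing letter of each color. `MinusculeOn.exists_compl_iff` shows
that this weight can be nonnegative exactly when no letter of the filter can be excited. -/

theorem smul_root (g : P.weylGroup) (i : ι) : g • P.root i = P.root (g • i) :=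
  P.weylGroup_apply_root g i

theorem ofIdx_smul_idx (i j : ι) : weylGroup.ofIdx P i • j = P.reflectionPerm i j := rfl

theorem ofIdx_smul_eq (i : ι) (x : M) :
    weylGroup.ofIdx P i • x = x - P.toLinearMap x (P.coroot i) • P.root i := rfl

theorem pairing_smul_smul (g : P.weylGroup) (x : M) (i : ι) :
    P.toLinearMap (g • x) (P.coroot (g • i)) = P.toLinearMap x (P.coroot i) := by
  obtain ⟨g, hg⟩ := g
  induction hg using weylGroup.induction generalizing x i with
  | mem j =>
    change P.coroot' (P.reflectionPerm j i) (P.reflection j x) = P.coroot' i x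
    rw [coroot'_reflectionPerm]
    simp
  | one => rfl
  | mul g h hg hh ihg ihh =>
    rw [← Submonoid.mk_mul_mk _ _ _ hg hh, mul_smul, mul_smul]
    exact (ihg _ _).trans (ihh _ _)

theorem pairing_smul_left (g : P.weylGroup) (x : M) (i : ι) :
    P.toLinearMap (g • x) (P.coroot i) = P.toLinearMap x (P.coroot (g⁻¹ • i)) := by
  rw [← pairing_smul_smul g x, smul_inv_smul]

theorem eq_of_forall_smul_eq {g h : P.weylGroup} (H : ∀ x : M, g • x = h • x) : g = h := by
  apply Subtype.ext
  apply Equiv.weightHom_injective P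
  ext x
  exact H x

theorem smul_weight_sub (g : P.weylGroup) (x y : M) : g • (x - y) = g • x - g • y := smul_sub g x y

theorem smul_weight_rat (g : P.weylGroup) (t : ℚ) (x : M) : g • (t • x) = t • (g • x) :=
  smul_comm g.1 t x

theorem conj_ofIdx (g : P.weylGroup) (i : ι) :
    g * weylGroup.ofIdx P i * g⁻¹ = weylGroup.ofIdx P (g • i) := by
  apply eq_of_forall_smul_eq
  intro x
  rw [mul_smul, mul_smul, ofIdx_smul_eq, ofIdx_smul_eq, smul_weight_sub, smul_weight_rat,
    smul_root, smul_inv_smul, pairing_smul_left, inv_inv]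

theorem ofIdx_mul (g : P.weylGroup) (i : ι) :
    weylGroup.ofIdx P (g • i) * g = g * weylGroup.ofIdx P i := by
  rw [← conj_ofIdx]; group

theorem ofIdx_mul_self (i : ι) : weylGroup.ofIdx P i * weylGroup.ofIdx P i = 1 := by
  apply eq_of_forall_smul_eq
  intro x
  rw [mul_smul, one_smul]
  change P.reflection i (P.reflection i x) = x
  simp

theorem ofIdx_inv (i : ι) : (weylGroup.ofIdx P i)⁻¹ = weylGroup.ofIdx P i :=
  inv_eq_of_mul_eq_one_left (ofIdx_mul_self i)

theorem coroot_neg_idx (i : ι) : P.coroot (weylGroup.ofIdx P i • i) = -P.coroot i := by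
  rw [ofIdx_smul_idx]; simp

theorem smul_neg_idx (g : P.weylGroup) (i : ι) :
    g • weylGroup.ofIdx P i • i = weylGroup.ofIdx P (g • i) • (g • i) := by
  rw [← mul_smul, ← ofIdx_mul, mul_smul]

theorem ofIdx_neg_idx (i : ι) :
    weylGroup.ofIdx P (weylGroup.ofIdx P i • i) = weylGroup.ofIdx P i := by
  rw [← conj_ofIdx, ofIdx_inv, ofIdx_mul_self, one_mul]

theorem isPos_neg_idx (b : P.Base) (i : ι) :
    b.IsPos (weylGroup.ofIdx P i • i) ↔ ¬ b.IsPos i :=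
  Base.IsPos.neg_iff_not b i

variable [Finite ι] [P.IsCrystallographic] [P.IsReduced] (b : P.Base)

theorem isPos_simpleReflection_smul {i : ι} (j : b.support) (hi : b.IsPos i) (hij : i ≠ j) :
    b.IsPos (simpleReflection b j • i) :=
  hi.reflectionPerm j.2 hij

omit [Finite ι] [P.IsCrystallographic] [P.IsReduced] in
theorem simpleReflection_mul_self (j : b.support) :
    simpleReflection b j * simpleReflection b j = 1 := ofIdx_mul_self _

theorem eq_of_isPos_of_not_isPos {i : ι} (j : b.support) (hi : b.IsPos i)
    (h : ¬ b.IsPos (simpleReflection b j • i)) : i = j := by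
  by_contra hij
  exact h (isPos_simpleReflection_smul b j hi hij)

/-- A simple reflection preserves positivity except for its own root and the negative of that root,
both for roots and for coroots. This lets dominance, stated on simple coroots, be used on all
positive coroots. -/
theorem isPos_iff_isPos_flip (i : ι) : b.IsPos i ↔ b.flip.IsPos i := by
  refine b.induction_reflect i (p := fun i ↦ b.IsPos i ↔ b.flip.IsPos i) ?_ ?_ ?_
  · intro i hi
    have h₁ := Base.IsPos.neg_iff_not b i
    have h₂ := Base.IsPos.neg_iff_not b.flip i
    exact h₁.trans ((not_congr hi).trans h₂.symm)
  · intro i hi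
    exact iff_of_true (b.isPos_of_mem_support hi) (b.flip.isPos_of_mem_support hi)
  · intro i j hi hj
    by_cases hij : i = j
    · subst hij
      exact (Base.IsPos.neg_iff_not b i).trans
        ((not_congr hi).trans (Base.IsPos.neg_iff_not b.flip i).symm)
    by_cases hij' : P.reflectionPerm j i = j
    · rw [hij']
      exact iff_of_true (b.isPos_of_mem_support hj) (b.flip.isPos_of_mem_support hj)
    have h₁ : b.IsPos (P.reflectionPerm j i) ↔ b.IsPos i := by
      refine ⟨fun h ↦ ?_, fun h ↦ h.reflectionPerm hj hij⟩
      simpa using h.reflectionPerm hj hij'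
    have h₂ : b.flip.IsPos (P.reflectionPerm j i) ↔ b.flip.IsPos i := by
      refine ⟨fun h ↦ ?_, fun h ↦ h.reflectionPerm (P := P.flip) (b := b.flip) hj hij⟩
      simpa using h.reflectionPerm (P := P.flip) (b := b.flip) hj hij'
    rw [h₁, h₂, hi]

theorem IsDominantIntegral.pairing_nonneg {b : P.Base} {π : M} (hπ : IsDominantIntegral b π)
    {i : ι} (hi : b.IsPos i) : 0 ≤ P.toLinearMap π (P.coroot i) := by
  rw [isPos_iff_isPos_flip] at hi
  obtain ⟨f, -, h | h⟩ := b.flip.exists_root_eq_sum_nat_or_neg i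
  · change P.coroot i = ∑ j ∈ b.support, f j • P.coroot j at h
    rw [h, map_sum]
    refine Finset.sum_nonneg fun j hj ↦ ?_
    obtain ⟨n, hn⟩ := hπ j hj
    rw [map_nsmul, hn]
    positivity
  · have h' : P.flip.root i = ∑ j ∈ b.flip.support, (fun j ↦ -(f j : ℤ)) j • P.flip.root j := by
      rw [h, ← Finset.sum_neg_distrib]
      simp
    have := Base.height_eq_sum h'
    rw [Base.isPos_iff, this] at hi
    have : ∑ j ∈ b.flip.support, -(f j : ℤ) ≤ 0 := Finset.sum_nonpos fun j _ ↦ by simp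
    exact absurd hi (not_lt.mpr this)

/-! ### Words and exchange -/

omit [Finite ι] [P.IsCrystallographic] [P.IsReduced] in
theorem wordProd_nil : wordProd b [] = 1 := rfl

omit [Finite ι] [P.IsCrystallographic] [P.IsReduced] in
theorem wordProd_cons (i : b.support) (ω : List b.support) :
    wordProd b (i :: ω) = simpleReflection b i * wordProd b ω := by simp [wordProd]

omit [Finite ι] [P.IsCrystallographic] [P.IsReduced] in
theorem wordProd_append (ω ω' : List b.support) :
    wordProd b (ω ++ ω') = wordProd b ω * wordProd b ω' := by simp [wordProd]

omit [Finite ι] [P.IsCrystallographic] [P.IsReduced] in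
theorem wordProd_reverse (ω : List b.support) : wordProd b ω.reverse = (wordProd b ω)⁻¹ := by
  induction ω with
  | nil => simp [wordProd_nil]
  | cons i ω ih =>
    rw [List.reverse_cons, wordProd_append, ih, wordProd_cons, wordProd_cons, wordProd_nil,
      mul_one, mul_inv_rev]
    congr 1
    exact (ofIdx_inv _).symm

theorem ofIdx_mem_closure (i : ι) :
    weylGroup.ofIdx P i ∈ Subgroup.closure (Set.range (simpleReflection b)) := by
  refine b.induction_reflect i
    (p := fun i ↦ weylGroup.ofIdx P i ∈ Subgroup.closure (Set.range (simpleReflection b))) ?_ ?_ ?_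
  · intro i hi
    rwa [← ofIdx_smul_idx, ofIdx_neg_idx]
  · intro i hi
    exact Subgroup.subset_closure ⟨⟨i, hi⟩, rfl⟩
  · intro i j hi hj
    have : weylGroup.ofIdx P j ∈ Subgroup.closure (Set.range (simpleReflection b)) :=
      Subgroup.subset_closure ⟨⟨j, hj⟩, rfl⟩
    rw [← ofIdx_smul_idx, ← conj_ofIdx]
    exact mul_mem (mul_mem this hi) (inv_mem this)

theorem exists_wordProd_eq (g : P.weylGroup) : ∃ ω, wordProd b ω = g := by
  have hcl : ∀ g ∈ Subgroup.closure (Set.range (simpleReflection b)), ∃ ω, wordProd b ω = g := by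
    intro g hg
    induction hg using Subgroup.closure_induction with
    | mem x hx =>
      obtain ⟨i, rfl⟩ := hx
      exact ⟨[i], by simp [wordProd]⟩
    | one => exact ⟨[], rfl⟩
    | mul x y _ _ hx hy =>
      obtain ⟨⟨ω, rfl⟩, ⟨ω', rfl⟩⟩ := And.intro hx hy
      exact ⟨ω ++ ω', wordProd_append b ω ω'⟩
    | inv x _ hx =>
      obtain ⟨ω, rfl⟩ := hx
      exact ⟨ω.reverse, wordProd_reverse b ω⟩
  obtain ⟨g, hg⟩ := g
  induction hg using weylGroup.induction with
  | mem i => exact hcl _ (ofIdx_mem_closure b i)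
  | one => exact ⟨[], rfl⟩
  | mul x y hx hy ihx ihy =>
    obtain ⟨⟨ω, h⟩, ⟨ω', h'⟩⟩ := And.intro ihx ihy
    exact ⟨ω ++ ω', by rw [wordProd_append, h, h']; rfl⟩

theorem exists_isReducedWord (g : P.weylGroup) : ∃ ω, IsReducedWord b ω g := by
  obtain ⟨ω, h⟩ := exists_wordProd_eq b g
  obtain ⟨ω', h₁, h₂⟩ := Nat.sInf_mem
    (s := {n : ℕ | ∃ ω : List b.support, ω.length = n ∧ wordProd b ω = g}) ⟨_, ω, rfl, h⟩
  exact ⟨ω', h₂, h₁⟩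

omit [Finite ι] [P.IsCrystallographic] [P.IsReduced] in
theorem length_wordProd_le (ω : List b.support) : length b (wordProd b ω) ≤ ω.length :=
  Nat.sInf_le ⟨ω, rfl, rfl⟩

theorem length_mul_le (g h : P.weylGroup) : length b (g * h) ≤ length b g + length b h := by
  obtain ⟨ω, rfl, hω⟩ := exists_isReducedWord b g
  obtain ⟨ω', rfl, hω'⟩ := exists_isReducedWord b h
  rw [← hω, ← hω', ← wordProd_append, ← List.length_append]
  exact length_wordProd_le b _

theorem length_inv (g : P.weylGroup) : length b g⁻¹ = length b g := by
  have key : ∀ g : P.weylGroup, length b g⁻¹ ≤ length b g := by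
    intro g
    obtain ⟨ω, rfl, hω⟩ := exists_isReducedWord b g
    rw [← hω, ← wordProd_reverse, ← List.length_reverse]
    exact length_wordProd_le b _
  exact le_antisymm (key g) (by simpa using key g⁻¹)

/-- The strong exchange condition. -/
theorem exists_sublist_of_not_isPos {i : ι} (hi : b.IsPos i) (ω : List b.support)
    (h : ¬ b.IsPos ((wordProd b ω)⁻¹ • i)) :
    ∃ σ : List b.support, σ.Sublist ω ∧ σ.length < ω.length ∧
      wordProd b σ = weylGroup.ofIdx P i * wordProd b ω := by
  induction ω generalizing i with
  | nil => simp [wordProd_nil, hi] at h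
  | cons j ω ih =>
    -- The deleted letter is the one at which the root turns negative; just before that it must be
    -- the simple root of the letter.
    by_cases hij : i = j
    · subst hij
      refine ⟨ω, List.sublist_cons_self _ _, by simp, ?_⟩
      rw [wordProd_cons, ← mul_assoc]
      exact ((simpleReflection_mul_self b j).symm ▸ one_mul _).symm
    · have hinv : (simpleReflection b j)⁻¹ = simpleReflection b j := ofIdx_inv _
      rw [wordProd_cons, mul_inv_rev, mul_smul, hinv] at h
      obtain ⟨σ, h₁, h₂, h₃⟩ := ih (isPos_simpleReflection_smul b j hi hij) h
      refine ⟨j :: σ, h₁.cons_cons j, by simpa using h₂, ?_⟩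
      rw [wordProd_cons, wordProd_cons, h₃, ← mul_assoc, ← mul_assoc, ← conj_ofIdx, hinv,
        ← mul_assoc, ← mul_assoc, simpleReflection_mul_self, one_mul]

/-- Otherwise exchange applies to `s_i g`, where the root has the opposite sign, and makes `g`
shorter than `s_i g`. -/
theorem not_isPos_of_length_lt {i : ι} (hi : b.IsPos i) {g : P.weylGroup}
    (h : length b (weylGroup.ofIdx P i * g) < length b g) : ¬ b.IsPos (g⁻¹ • i) := by
  intro hpos
  obtain ⟨ω, hω, hl⟩ := exists_isReducedWord b (weylGroup.ofIdx P i * g)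
  obtain ⟨σ, -, h₂, h₃⟩ := exists_sublist_of_not_isPos b hi ω (by
    rw [hω, mul_inv_rev, mul_smul, ofIdx_inv, smul_neg_idx, isPos_neg_idx, not_not]
    exact hpos)
  rw [hω, ← mul_assoc, ofIdx_mul_self, one_mul] at h₃
  have := length_wordProd_le b σ
  rw [h₃] at this
  omega

theorem length_lt_of_not_isPos {i : ι} (hi : b.IsPos i) {g : P.weylGroup}
    (h : ¬ b.IsPos (g⁻¹ • i)) : length b (weylGroup.ofIdx P i * g) < length b g := by
  obtain ⟨ω, rfl, hl⟩ := exists_isReducedWord b g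
  obtain ⟨σ, -, h₂, h₃⟩ := exists_sublist_of_not_isPos b hi ω h
  rw [← h₃, ← hl]
  exact (length_wordProd_le b σ).trans_lt h₂

theorem length_mul_ofIdx_lt {i : ι} (hi : b.IsPos i) {g : P.weylGroup}
    (h : ¬ b.IsPos (g • i)) : length b (g * weylGroup.ofIdx P i) < length b g := by
  rw [← length_inv b (_ * _), ← length_inv b g, mul_inv_rev, ofIdx_inv]
  exact length_lt_of_not_isPos b hi (by rwa [inv_inv])

/-- Half of the subword property: each step down a Bruhat chain passes to a sublist by strong
exchange. -/
theorem BruhatLE.exists_sublist {b : P.Base} {v w : P.weylGroup} (h : BruhatLE b v w)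
    {ω : List b.support} (hω : wordProd b ω = w) :
    ∃ σ : List b.support, σ.Sublist ω ∧ wordProd b σ = v := by
  induction h generalizing ω with
  | refl => exact ⟨ω, List.Sublist.refl _, hω⟩
  | @tail x y _ hxy ih =>
    obtain ⟨β, rfl, hlt⟩ := hxy
    -- The root β in the Bruhat step may be negative; -β gives the same reflection.
    obtain ⟨γ, hγ, hγβ⟩ : ∃ γ, b.IsPos γ ∧ weylGroup.ofIdx P γ = weylGroup.ofIdx P β := by
      by_cases hβ : b.IsPos β
      · exact ⟨β, hβ, rfl⟩
      · exact ⟨_, (isPos_neg_idx b β).2 hβ, ofIdx_neg_idx β⟩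
    rw [← hγβ] at hlt hω
    have hx : weylGroup.ofIdx P γ * (weylGroup.ofIdx P γ * x) = x := by
      rw [← mul_assoc, ofIdx_mul_self, one_mul]
    obtain ⟨σ, h₁, -, h₃⟩ := exists_sublist_of_not_isPos b hγ ω
      (hω ▸ not_isPos_of_length_lt b hγ (by rwa [hx]))
    rw [hω, hx] at h₃
    obtain ⟨τ, h₄, h₅⟩ := ih h₃
    exact ⟨τ, h₄.trans h₁, h₅⟩

theorem exists_simple_not_isPos {g : P.weylGroup} (hg : g ≠ 1) :
    ∃ j : b.support, ¬ b.IsPos (g • (j : ι)) := by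
  obtain ⟨ω, hω, hl⟩ := exists_isReducedWord b g
  rcases List.eq_nil_or_concat ω with rfl | ⟨σ, j, rfl⟩
  · exact absurd hω.symm hg
  · refine ⟨j, fun hpos ↦ ?_⟩
    have hj : g * weylGroup.ofIdx P (j : ι) = wordProd b σ := by
      rw [← hω, List.concat_eq_append, wordProd_append, mul_assoc]
      simp only [wordProd, List.map_cons, List.map_nil, List.prod_cons, List.prod_nil, mul_one]
      rw [simpleReflection, ofIdx_mul_self, mul_one]
    have hlt := length_mul_ofIdx_lt b (g := wordProd b σ) (b.isPos_of_mem_support j.2) (by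
      rw [← hj, mul_smul, smul_neg_idx, isPos_neg_idx, not_not]
      exact hpos)
    rw [← hj, mul_assoc, ofIdx_mul_self, mul_one, hj] at hlt
    have := length_wordProd_le b σ
    simp at hl
    omega

end

/-! ### Minuscule words -/

section

variable {ι M N : Type*} [AddCommGroup M] [Module ℚ M] [AddCommGroup N] [Module ℚ N]
  {P : RootPairing ι ℚ M N} (b : P.Base)

/-- `ω` is a minuscule word for the weight `π`. -/
def IsMinusculeWord (π : M) (ω : List b.support) : Prop :=
  ∀ k : Fin ω.length, P.toLinearMap (wordProd b (ω.drop (k + 1)) • π) (P.coroot (ω.get k)) = 1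

theorem isMinusculeWord_cons {π : M} {i : b.support} {ω : List b.support} :
    IsMinusculeWord b π (i :: ω) ↔
      P.toLinearMap (wordProd b ω • π) (P.coroot i) = 1 ∧ IsMinusculeWord b π ω := by
  unfold IsMinusculeWord
  exact Fin.forall_fin_succ

theorem isMinusculeWord_nil (π : M) : IsMinusculeWord b π [] := fun k ↦ k.elim0

variable {b}

theorem IsMinusculeWord.smul_eq {π : M} {ω : List b.support} (h : IsMinusculeWord b π ω) :
    wordProd b ω • π = π - (ω.map fun i : b.support ↦ P.root i).sum := by
  induction ω with
  | nil => simp [wordProd_nil]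
  | cons i ω ih =>
    rw [isMinusculeWord_cons] at h
    rw [wordProd_cons, mul_smul, simpleReflection, ofIdx_smul_eq, h.1, ih h.2]
    simp only [List.map_cons, List.sum_cons]
    module

variable [Finite ι] [P.IsCrystallographic] [P.IsReduced]

/-- An inversion turns negative at some letter, where it has become that letter's simple root.
Invariance of the pairing transports the value 1 back to π. With the converse below, being minuscule
depends only on the inversions of `w`, not on the reduced word. -/
theorem IsMinusculeWord.pairing_eq_one {π : M} {ω : List b.support} (h : IsMinusculeWord b π ω)
    {i : ι} (hi : b.IsPos i) (hwi : ¬ b.IsPos (wordProd b ω • i)) :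
    P.toLinearMap π (P.coroot i) = 1 := by
  induction ω with
  | nil => simp [wordProd_nil, hi] at hwi
  | cons j ω ih =>
    rw [isMinusculeWord_cons] at h
    by_cases hpos : b.IsPos (wordProd b ω • i)
    · rw [wordProd_cons, mul_smul] at hwi
      rw [← h.1, ← eq_of_isPos_of_not_isPos b j hpos hwi, pairing_smul_smul]
    · exact ih h.2 hpos

theorem IsReducedWord.isMinusculeWord {π : M} {ω : List b.support} {w : P.weylGroup}
    (hω : IsReducedWord b ω w)
    (h : ∀ i, b.IsPos i → ¬ b.IsPos (w • i) → P.toLinearMap π (P.coroot i) = 1) :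
    IsMinusculeWord b π ω := by
  intro k
  obtain ⟨rfl, hl⟩ := hω
  have hsplit : ω = ω.take k ++ ω.get k :: ω.drop (k + 1) := by simp
  have hlen : (ω.take k).length + (ω.drop (k + 1)).length + 1 = ω.length := by
    conv_rhs => rw [hsplit]
    simp only [List.length_append, List.length_cons]
    omega
  generalize ω.take k = σ, ω.get k = i, ω.drop (k + 1) = τ at hsplit hlen
  subst hsplit
  rw [pairing_smul_left]
  -- The root τ⁻¹α_i is shown to be an inversion of w: in either failing case the word σ i τ could
  -- be shortened.
  have hi := b.isPos_of_mem_support i.2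
  have h₁ := length_wordProd_le b σ
  have h₂ := length_wordProd_le b τ
  have hw : wordProd b (σ ++ i :: τ) =
      wordProd b σ * weylGroup.ofIdx P (i : ι) * wordProd b τ := by
    rw [wordProd_append, wordProd_cons, ← mul_assoc]; rfl
  rw [hw] at hl h
  apply h
  · by_contra hneg
    have h₃ := length_lt_of_not_isPos b hi hneg
    have h₄ := length_mul_le b (wordProd b σ) (weylGroup.ofIdx P (i : ι) * wordProd b τ)
    rw [← mul_assoc] at h₄
    omega
  · rw [mul_smul, smul_inv_smul, mul_smul, smul_neg_idx, isPos_neg_idx, not_not]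
    by_contra hneg
    have h₃ := length_mul_ofIdx_lt b hi hneg
    have h₄ := length_mul_le b (wordProd b σ * weylGroup.ofIdx P (i : ι)) (wordProd b τ)
    omega

theorem IsReducedWord.isMinuscule_iff {π : M} {ω : List b.support} {w : P.weylGroup}
    (hω : IsReducedWord b ω w) : IsMinuscule b π w ↔ IsMinusculeWord b π ω := by
  refine ⟨fun ⟨σ, hσ, hM⟩ ↦ hω.isMinusculeWord fun i hi hwi ↦ ?_, fun h ↦ ⟨ω, hω, h⟩⟩
  exact IsMinusculeWord.pairing_eq_one (ω := σ) hM hi (by rwa [hσ.1])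

/-- If a letter failed to increase the length, some positive coroot would pair to -1 with the
dominant weight. -/
theorem IsMinusculeWord.isReducedWord {π : M} (hπ : IsDominantIntegral b π) {ω : List b.support}
    (h : IsMinusculeWord b π ω) : IsReducedWord b ω (wordProd b ω) := by
  refine ⟨rfl, ?_⟩
  induction ω with
  | nil => exact le_antisymm (Nat.zero_le _) (length_wordProd_le b [])
  | cons j ω ih =>
    rw [isMinusculeWord_cons] at h
    refine le_antisymm ?_ (length_wordProd_le b _)
    rw [List.length_cons, ih h.2, wordProd_cons]
    have hpos : b.IsPos ((wordProd b ω)⁻¹ • (j : ι)) := by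
      by_contra hneg
      have h₁ := hπ.pairing_nonneg ((isPos_neg_idx b _).2 hneg)
      rw [coroot_neg_idx, map_neg, ← pairing_smul_left, h.1] at h₁
      norm_num at h₁
    have h₂ := length_lt_of_not_isPos b (b.isPos_of_mem_support j.2)
      (g := simpleReflection b j * wordProd b ω) (by
        rw [mul_inv_rev, mul_smul, simpleReflection, ofIdx_inv, smul_neg_idx, isPos_neg_idx,
          not_not]
        exact hpos)
    rw [← mul_assoc, simpleReflection, ofIdx_mul_self, one_mul] at h₂
    exact h₂

theorem IsMinCosetRep.pairing_ne_zero {π : M} {v : P.weylGroup} (hv : IsMinCosetRep b π v) {i : ι}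
    (hi : b.IsPos i) (hvi : ¬ b.IsPos (v • i)) : P.toLinearMap π (P.coroot i) ≠ 0 := by
  intro h
  have h₁ := hv (weylGroup.ofIdx P i) (by
    rw [MulAction.mem_stabilizer_iff, ofIdx_smul_eq, h, zero_smul, sub_zero])
  exact absurd (length_mul_ofIdx_lt b hi hvi) (not_lt.2 h₁)

/-- If v'⁻¹v ≠ 1, it fixes π and sends some simple α_j to -γ with γ > 0. Dominance makes both roots
orthogonal to π. But either α_j is an inversion of v, or γ is one of v'. -/
theorem eq_of_smul_eq {π : M} (hπ : IsDominantIntegral b π) {v v' : P.weylGroup}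
    (hv : ∀ i, b.IsPos i → ¬ b.IsPos (v • i) → P.toLinearMap π (P.coroot i) ≠ 0)
    (hv' : ∀ i, b.IsPos i → ¬ b.IsPos (v' • i) → P.toLinearMap π (P.coroot i) ≠ 0)
    (h : v • π = v' • π) : v = v' := by
  by_contra hne
  have hg : v'⁻¹ * v ≠ 1 := fun h ↦ hne (inv_mul_eq_one.1 h).symm
  obtain ⟨j, hj⟩ := exists_simple_not_isPos b hg
  have hjpos := b.isPos_of_mem_support j.2
  have hstab : (v'⁻¹ * v) • π = π := by rw [mul_smul, h, inv_smul_smul]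
  have hpair := pairing_smul_smul (v'⁻¹ * v) π (j : ι)
  rw [hstab] at hpair
  have hγ := (isPos_neg_idx b _).2 hj
  have h₁ := hπ.pairing_nonneg hγ
  have h₂ := hπ.pairing_nonneg hjpos
  rw [coroot_neg_idx, map_neg, hpair] at h₁
  have h₀ : P.toLinearMap π (P.coroot j) = 0 := by linarith
  have h₃ : b.IsPos (v • (j : ι)) := by_contra fun h ↦ hv _ hjpos h h₀
  refine hv' _ hγ ?_ (by rw [coroot_neg_idx, map_neg, hpair, h₀, neg_zero])
  rw [smul_neg_idx, isPos_neg_idx, not_not, mul_smul, smul_inv_smul]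
  exact h₃

end

/-! ### Subwords -/

section

variable {I : Type*}

open Classical in
/-- The letters of `ω` at the positions satisfying `p`. -/
noncomputable def subwordOf (ω : List I) (p : Fin ω.length → Prop) : List I :=
  ((List.finRange ω.length).filter fun k ↦ p k).map ω.get

theorem subwordOf_cons_pos {i : I} {ω : List I} {p : Fin (i :: ω).length → Prop} (h : p 0) :
    subwordOf (i :: ω) p = i :: subwordOf ω fun k ↦ p k.succ := by
  simp only [subwordOf, List.length_cons, List.finRange_succ]
  rw [List.filter_cons_of_pos (by simpa using h), List.map_cons, List.filter_map, List.map_map]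
  rfl

theorem subwordOf_cons_neg {i : I} {ω : List I} {p : Fin (i :: ω).length → Prop} (h : ¬ p 0) :
    subwordOf (i :: ω) p = subwordOf ω fun k ↦ p k.succ := by
  simp only [subwordOf, List.length_cons, List.finRange_succ]
  rw [List.filter_cons_of_neg (by simpa using h), List.filter_map, List.map_map]
  rfl

theorem subwordOf_true (ω : List I) : subwordOf ω (fun _ ↦ True) = ω := by
  simp [subwordOf]

theorem sum_map_subwordOf {M : Type*} [AddCommMonoid M] (f : I → M) (ω : List I)
    (p : Fin ω.length → Prop) [DecidablePred p] :
    ((subwordOf ω p).map f).sum = ∑ k with p k, f (ω.get k) := by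
  induction ω with
  | nil => simp [subwordOf]
  | cons i ω ih =>
    rw [Finset.sum_filter]
    erw [Fin.sum_univ_succ]
    rw [← Finset.sum_filter]
    by_cases h : p 0
    · rw [subwordOf_cons_pos h, if_pos h, List.map_cons, List.sum_cons, ih]; rfl
    · rw [subwordOf_cons_neg h, if_neg h, ih, zero_add]; rfl

theorem length_subwordOf_add (ω : List I) (p : Fin ω.length → Prop) :
    (subwordOf ω fun k ↦ ¬ p k).length + (subwordOf ω p).length = ω.length := by
  induction ω with
  | nil => simp [subwordOf]
  | cons i ω ih =>
    have := ih fun k ↦ p k.succ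
    by_cases h : p 0
    · rw [subwordOf_cons_pos h, subwordOf_cons_neg (by simpa using h), List.length_cons,
        List.length_cons]
      omega
    · rw [subwordOf_cons_neg h, subwordOf_cons_pos h, List.length_cons,
        List.length_cons]
      omega

end

section

variable {ι M N : Type*} [AddCommGroup M] [Module ℚ M] [AddCommGroup N] [Module ℚ N]
  {P : RootPairing ι ℚ M N} {b : P.Base}

/-- Selected letters slide to the right past the later unselected ones. -/
theorem wordProd_subwordOf_mul (ω : List b.support) (p : Fin ω.length → Prop)
    (h : ∀ j k, j < k → p j → ¬ p k →
      Commute (simpleReflection b (ω.get j)) (simpleReflection b (ω.get k))) :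
    wordProd b (subwordOf ω fun k ↦ ¬ p k) * wordProd b (subwordOf ω p) = wordProd b ω := by
  induction ω with
  | nil => simp [subwordOf, wordProd_nil]
  | cons i ω ih =>
    have ih' := ih (fun k ↦ p k.succ) fun j k hjk hj hk ↦ h j.succ k.succ (by simpa) hj hk
    by_cases h₀ : p 0
    · rw [subwordOf_cons_pos h₀, subwordOf_cons_neg (by simpa using h₀), wordProd_cons,
        wordProd_cons, ← ih', ← mul_assoc, ← mul_assoc]
      congr 1
      refine Commute.symm (Commute.list_prod_right _ _ fun x hx ↦ ?_)
      rw [List.mem_map] at hx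
      obtain ⟨j, hj, rfl⟩ := hx
      simp only [subwordOf, List.mem_map, List.mem_filter, decide_eq_true_eq] at hj
      obtain ⟨k, ⟨-, hk⟩, rfl⟩ := hj
      exact h 0 k.succ (Fin.succ_pos k) h₀ hk
    · rw [subwordOf_cons_neg h₀, subwordOf_cons_pos h₀, wordProd_cons, wordProd_cons, ← ih',
        mul_assoc]

theorem isMinusculeWord_subwordOf_iff {π : M} (ω : List b.support) (p : Fin ω.length → Prop)
    [DecidablePred p] :
    IsMinusculeWord b π (subwordOf ω p) ↔ ∀ k, p k →
      P.toLinearMap π (P.coroot (ω.get k)) -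
        ∑ j with p j ∧ k < j, P.pairing (ω.get j) (ω.get k) = 1 := by
  induction ω with
  | nil => simp [subwordOf, isMinusculeWord_nil]
  | cons i ω ih =>
    have ih' := ih fun k ↦ p k.succ
    have hrec : (∀ k : Fin (i :: ω).length, p k →
        P.toLinearMap π (P.coroot ((i :: ω).get k)) -
          ∑ j with p j ∧ k < j, P.pairing ((i :: ω).get j) ((i :: ω).get k) = 1) ↔
        (p 0 → P.toLinearMap π (P.coroot i) -
          ∑ j : Fin ω.length with p j.succ, P.pairing (ω.get j) i = 1) ∧
        ∀ k : Fin ω.length, p k.succ → P.toLinearMap π (P.coroot (ω.get k)) -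
          ∑ j : Fin ω.length with p j.succ ∧ k < j, P.pairing (ω.get j) (ω.get k) = 1 := by
      have hs : ∀ (q : Fin (ω.length + 1) → Prop) [DecidablePred q] (f : Fin (ω.length + 1) → ℚ), ¬ q 0 →
          ∑ j with q j, f j = ∑ j : Fin ω.length with q j.succ, f j.succ := by
        intro q _ f hq
        rw [Finset.sum_filter, Fin.sum_univ_succ, if_neg hq, zero_add, ← Finset.sum_filter]
      refine Fin.forall_fin_succ.trans (and_congr ?_ (forall_congr' fun k ↦ ?_))
      · refine imp_congr_right fun _ ↦ ?_
        refine Eq.congr (congrArg _ ((hs _ _ (by simp)).trans ?_)) rfl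
        simp
      · refine imp_congr_right fun _ ↦ ?_
        refine Eq.congr (congrArg _ ((hs _ _ (by simp)).trans ?_)) rfl
        simp
    rw [hrec, ← ih']
    by_cases h : p 0
    · rw [subwordOf_cons_pos h, isMinusculeWord_cons]
      refine and_congr_left fun hM ↦ ?_
      rw [hM.smul_eq, sum_map_subwordOf]
      simp [h]
    · rw [subwordOf_cons_neg h]
      simp [h]

end

/-! ### Combinatorics of minuscule words over a Cartan matrix -/

/-- The properties of a (generalized) Cartan matrix. -/
structure IsCartan {I : Type*} (A : I → I → ℤ) : Prop where
  diag : ∀ i, A i i = 2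
  nonpos : ∀ i j, i ≠ j → A i j ≤ 0
  zero_symm : ∀ i j, A i j = 0 → A j i = 0

/-- The letters at the positions in `S` form a minuscule word for the weight with coordinates `n`. -/
def MinusculeOn {I : Type*} (A : I → I → ℤ) {l : ℕ} (c : Fin l → I) (n : I → ℤ)
    (S : Finset (Fin l)) : Prop :=
  ∀ k ∈ S, n (c k) - ∑ j ∈ S with k < j, A (c j) (c k) = 1

/-- `S` is closed under passing to later positions with an adjacent letter. -/
def AdjClosed {I : Type*} (A : I → I → ℤ) {l : ℕ} (c : Fin l → I) (S : Finset (Fin l)) : Prop :=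
  ∀ j k, j < k → c j ≠ c k → A (c j) (c k) ≠ 0 → j ∈ S → k ∈ S

theorem sum_filter_lt_split {l : ℕ} (S : Finset (Fin l)) {j q : Fin l} (hjq : j < q) (hq : q ∈ S)
    (f : Fin l → ℤ) : ∑ z ∈ S with j < z, f z =
      f q + (∑ z ∈ S with j < z ∧ z < q, f z + ∑ z ∈ S with q < z, f z) := by
  have h : (S.filter fun z ↦ j < z) =
      insert q ((S.filter fun z ↦ j < z ∧ z < q) ∪ S.filter fun z ↦ q < z) := by
    ext z
    simp only [Finset.mem_filter, Finset.mem_insert, Finset.mem_union]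
    grind
  rw [h, Finset.sum_insert (by simp), Finset.sum_union]
  rw [Finset.disjoint_left]
  intro z
  simp only [Finset.mem_filter]
  grind

section Combinatorics

variable {I : Type*} {A : I → I → ℤ} (hA : IsCartan A) {l : ℕ} {c : Fin l → I} {n : I → ℤ}
  (hM : MinusculeOn A c n Finset.univ)

include hA hM

theorem MinusculeOn.sum_between {j q : Fin l} (hjq : j < q) (hc : c j = c q) :
    ∑ z with j < z ∧ z < q, A (c z) (c q) = -2 := by
  have h₁ := hM j (Finset.mem_univ _)
  have h₂ := hM q (Finset.mem_univ _)
  rw [sum_filter_lt_split _ hjq (Finset.mem_univ _), hc, hA.diag] at h₁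
  linarith

/-- Letters of the same color contribute +2, so a total of -2 needs an adjacent letter. -/
theorem MinusculeOn.exists_adj_between {j q : Fin l} (hjq : j < q) (hc : c j = c q) :
    ∃ z, j < z ∧ z < q ∧ c z ≠ c q ∧ A (c z) (c q) ≠ 0 := by
  by_contra! h
  have hs := hM.sum_between hA hjq hc
  have : 0 ≤ ∑ z with j < z ∧ z < q, A (c z) (c q) := by
    refine Finset.sum_nonneg fun z hz ↦ ?_
    simp only [Finset.mem_filter, Finset.mem_univ, true_and] at hz
    by_cases hcz : c z = c q
    · rw [hcz, hA.diag]; norm_num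
    · rw [h z hz.1 hz.2 hcz]
  omega

theorem MinusculeOn.mem_of_color_eq {F : Finset (Fin l)} (hF : AdjClosed A c F) {j q : Fin l}
    (hjq : j < q) (hc : c j = c q) (hj : j ∈ F) : q ∈ F := by
  obtain ⟨z, h₁, h₂, h₃, h₄⟩ := hM.exists_adj_between hA hjq hc
  refine hF z q h₂ h₃ h₄ (hF j z h₁ (by rwa [hc, ne_comm]) ?_ hj)
  rw [hc]
  exact fun h ↦ h₄ (hA.zero_symm _ _ h)

theorem MinusculeOn.pairing_eq_zero {F : Finset (Fin l)} (hF : AdjClosed A c F) {j q : Fin l}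
    (hjq : j < q) (hj : j ∈ F) (hq : q ∉ F) : c j ≠ c q ∧ A (c j) (c q) = 0 := by
  have hc : c j ≠ c q := fun hc ↦ hq (hM.mem_of_color_eq hA hF hjq hc hj)
  refine ⟨hc, ?_⟩
  by_contra h
  exact hq (hF j q hjq hc h hj)

theorem MinusculeOn.of_adjClosed {F : Finset (Fin l)} (hF : AdjClosed A c F) :
    MinusculeOn A c n F := by
  intro k hk
  rw [← hM k (Finset.mem_univ _)]
  congr 1
  refine Finset.sum_subset (fun z hz ↦ by simp_all) fun z hz hz' ↦ ?_
  simp only [Finset.mem_filter, Finset.mem_univ, true_and] at hz hz'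
  exact hA.zero_symm _ _ (hM.pairing_eq_zero hA hF hz hk fun h ↦ hz' ⟨h, hz⟩).2

/-- If the simple coroot of the letter at the missing position `k` pairs positively with the
weight of `F`, then `F` extends by one letter of that color. -/
theorem MinusculeOn.exists_insert {F : Finset (Fin l)} (hF : AdjClosed A c F) {k : Fin l}
    (hk : k ∉ F) (hpos : 0 < n (c k) - ∑ j ∈ F, A (c j) (c k)) :
    ∃ q, k ≤ q ∧ q ∉ F ∧ c q = c k ∧ n (c k) - ∑ j ∈ F, A (c j) (c k) = 1 ∧
      AdjClosed A c (insert q F) := by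
  classical
  -- The letter to add is the last missing one of its color. Its equation reads (pairing) = 1 + (sum
  -- over later missing letters), and that sum is ≤ 0; positivity forces the pairing to be 1 and
  -- each term to vanish.
  obtain ⟨q, hq⟩ := (Finset.univ.filter fun z ↦ z ∉ F ∧ c z = c k).exists_maximal
    ⟨k, by simp [hk]⟩
  have hq' := hq.prop
  simp only [Finset.mem_filter, Finset.mem_univ, true_and] at hq'
  have hmax : ∀ z, z ∉ F → c z = c k → z ≤ q := fun z hz hzk ↦ by
    rcases le_total z q with h | h
    · exact h
    · exact hq.le_of_ge (by simp [hz, hzk]) h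
  have h₁ := hM q (Finset.mem_univ _)
  rw [hq'.2, ← Finset.sum_filter_add_sum_filter_not _ (· ∈ F), Finset.filter_filter,
    Finset.filter_filter] at h₁
  have h₂ : ∑ z with q < z ∧ z ∈ F, A (c z) (c k) = ∑ j ∈ F, A (c j) (c k) := by
    refine Finset.sum_subset (fun z hz ↦ by simp_all) fun z hz hz' ↦ ?_
    simp only [Finset.mem_filter, Finset.mem_univ, true_and] at hz'
    have hzq : z < q := lt_of_le_of_ne (not_lt.1 fun h ↦ hz' ⟨h, hz⟩) fun h ↦ hq'.1 (h ▸ hz)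
    rw [← hq'.2]
    exact (hM.pairing_eq_zero hA hF hzq hz hq'.1).2
  have hnp : ∀ z ∈ Finset.univ.filter (fun z ↦ q < z ∧ z ∉ F), A (c z) (c k) ≤ 0 := by
    intro z hz
    simp only [Finset.mem_filter, Finset.mem_univ, true_and] at hz
    exact hA.nonpos _ _ fun h ↦ absurd (hmax z hz.2 h) (not_le.2 hz.1)
  have h₃ := Finset.sum_nonpos hnp
  have h₄ : ∑ z with q < z ∧ z ∉ F, A (c z) (c k) = 0 := by omega
  rw [Finset.sum_eq_zero_iff_of_nonpos hnp] at h₄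
  refine ⟨q, hmax k hk rfl, hq'.1, hq'.2, by omega, fun i j hij hc hne hi ↦ ?_⟩
  rcases Finset.mem_insert.1 hi with rfl | hi
  · refine Finset.mem_insert_of_mem (by_contra fun hj ↦ hne ?_)
    rw [hq'.2]
    exact hA.zero_symm _ _ (h₄ j (by simp [hij, hj]))
  · exact Finset.mem_insert_of_mem (hF i j hij hc hne hi)

/-- If a simple coroot pairs negatively with the weight of `F`, then a letter of that color can be
removed from `F`. -/
theorem MinusculeOn.exists_erase {F : Finset (Fin l)} (hF : AdjClosed A c F) {i : I}
    (hn : 0 ≤ n i) (hneg : n i - ∑ j ∈ F, A (c j) i < 0) :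
    ∃ r ∈ F, c r = i ∧ n i - ∑ j ∈ F, A (c j) i = -1 ∧ AdjClosed A c (F.erase r) := by
  classical
  have hne : (F.filter fun z ↦ c z = i).Nonempty := by
    by_contra hne
    rw [Finset.not_nonempty_iff_eq_empty, Finset.filter_eq_empty_iff] at hne
    have := Finset.sum_nonpos fun j hj ↦ hA.nonpos (c j) i (hne hj)
    omega
  -- The letter to remove is the first of its color in `F`. By its equation the pairing is 1 - 2
  -- minus a nonpositive sum over earlier letters of `F`; negativity makes that sum vanish, so no
  -- earlier letter of `F` is adjacent to it.
  obtain ⟨r, hr⟩ := (F.filter fun z ↦ c z = i).exists_minimal hne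
  have hr' := hr.prop
  simp only [Finset.mem_filter] at hr'
  obtain ⟨hrF, rfl⟩ := hr'
  have hmin : ∀ z ∈ F, c z = c r → r ≤ z := fun z hz hzk ↦ by
    rcases le_total r z with h | h
    · exact h
    · exact hr.le_of_le (by simp [hz, hzk]) h
  have h₁ := hM.of_adjClosed hA hF r hrF
  have hsplit : F = insert r ((F.filter fun z ↦ r < z) ∪ F.filter fun z ↦ z < r) := by
    ext z
    simp only [Finset.mem_filter, Finset.mem_insert, Finset.mem_union]
    grind
  have hsum : ∑ j ∈ F, A (c j) (c r) =
      2 + (∑ j ∈ F with r < j, A (c j) (c r) + ∑ j ∈ F with j < r, A (c j) (c r)) := by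
    conv_lhs => rw [hsplit]
    rw [Finset.sum_insert (by simp), Finset.sum_union (by
      rw [Finset.disjoint_left]; intro z; simp only [Finset.mem_filter]; grind), hA.diag]
  have hnp : ∀ z ∈ F.filter (fun z ↦ z < r), A (c z) (c r) ≤ 0 := by
    intro z hz
    simp only [Finset.mem_filter] at hz
    exact hA.nonpos _ _ fun h ↦ absurd (hmin z hz.1 h) (not_le.2 hz.2)
  have h₃ := Finset.sum_nonpos hnp
  have h₄ : ∑ j ∈ F with j < r, A (c j) (c r) = 0 := by omega
  rw [Finset.sum_eq_zero_iff_of_nonpos hnp] at h₄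
  refine ⟨r, hrF, rfl, by omega, fun i j hij hc hij0 hi ↦ ?_⟩
  have hi' := Finset.mem_of_mem_erase hi
  refine Finset.mem_erase.2 ⟨?_, hF i j hij hc hij0 hi'⟩
  rintro rfl
  exact hij0 (h₄ i (by simp [hi', hij]))

/-- In each color both filters are final segments, so the smaller count gives the smaller segment.
-/
theorem MinusculeOn.subset_of_count_le [DecidableEq I] {F G : Finset (Fin l)}
    (hF : AdjClosed A c F) (hG : AdjClosed A c G)
    (h : ∀ i, (F.filter fun k ↦ c k = i).card ≤ (G.filter fun k ↦ c k = i).card) : F ⊆ G := by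
  intro k hk
  by_contra hkG
  refine absurd (h (c k)) (not_le.2 (Finset.card_lt_card ⟨fun r hr ↦ ?_, fun hle ↦ ?_⟩))
  · simp only [Finset.mem_filter] at hr ⊢
    refine ⟨?_, hr.2⟩
    rcases lt_trichotomy k r with hkr | rfl | hkr
    · exact hM.mem_of_color_eq hA hF hkr hr.2.symm hk
    · exact hk
    · exact absurd (hM.mem_of_color_eq hA hG hkr hr.2 hr.1) hkG
  · have := hle (Finset.mem_filter.2 ⟨hk, rfl⟩)
    exact hkG (Finset.mem_filter.1 this).1

/-- The letters outside an order filter form a minuscule word for some dominant weight if and only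
if no letter of the filter can be excited. -/
theorem MinusculeOn.exists_compl_iff (hn : ∀ i, 0 ≤ n i) {F : Finset (Fin l)}
    (hF : AdjClosed A c F) :
    (∃ n' : I → ℤ, (∀ i, 0 ≤ n' i) ∧ MinusculeOn A c n' Fᶜ) ↔
      ¬ ∃ p q, p < q ∧ p ∉ F ∧ q ∈ F ∧ c p = c q ∧ (∀ z, p < z → z < q → c z ≠ c p) ∧
        ∀ u ∈ F, p < u → u < q → A (c u) (c p) = 0 := by
  classical
  constructor
  · rintro ⟨n', hn', hM'⟩ ⟨p, q, hpq, hp, hq, hc, hz, hu⟩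
    have h₁ := hM' p (by simpa using hp)
    have h₂ := hM.sum_between hA hpq hc
    rw [← hc] at h₂
    -- The right side is -2, so the equation at `p` would give n' ≤ -1 on its color.
    have h₃ : ∑ j ∈ Fᶜ with p < j, A (c j) (c p) ≤ ∑ z with p < z ∧ z < q, A (c z) (c p) := by
      rw [← Finset.sum_filter_add_sum_filter_not (Finset.filter _ Fᶜ) (· < q),
        ← Finset.sum_filter_add_sum_filter_not (Finset.univ.filter _) (· ∈ F)]
      have e₁ : ∑ x ∈ (Finset.univ.filter fun z ↦ p < z ∧ z < q) with x ∈ F, A (c x) (c p) = 0 := by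
        refine Finset.sum_eq_zero fun x hx ↦ ?_
        simp only [Finset.mem_filter, Finset.mem_univ, true_and] at hx
        exact hu x hx.2 hx.1.1 hx.1.2
      have e₂ : ∑ x ∈ (Fᶜ.filter fun z ↦ p < z) with ¬ x < q, A (c x) (c p) ≤ 0 := by
        refine Finset.sum_nonpos fun x hx ↦ hA.nonpos _ _ fun hcx ↦ ?_
        simp only [Finset.mem_filter, Finset.mem_compl] at hx
        have hqx : q < x := lt_of_le_of_ne (not_lt.1 hx.2) fun h ↦ hx.1.1 (h ▸ hq)
        exact hx.1.1 (hM.mem_of_color_eq hA hF hqx (hc.symm.trans hcx.symm) hq)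
      have e₃ : (Fᶜ.filter fun z ↦ p < z).filter (fun z ↦ z < q) =
          (Finset.univ.filter fun z ↦ p < z ∧ z < q).filter (fun z ↦ z ∉ F) := by
        ext z
        simp only [Finset.mem_filter, Finset.mem_univ, true_and, Finset.mem_compl]
        tauto
      rw [e₁, e₃]
      linarith
    linarith [hn' (c p)]
  · intro hex
    -- The value of n' forced by the last missing letter `p`. If negative, the missing letters after
    -- `p` contribute at most -2. Then a next letter `q` of this color exists, or n would be
    -- negative; it lies in `F`, and the total -2 leaves nothing for `F` between `p` and `q`: an
    -- excitation.
    have key : ∀ p, p ∉ F → (∀ z, z ∉ F → c z = c p → z ≤ p) →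
        0 ≤ 1 + ∑ j ∈ Fᶜ with p < j, A (c j) (c p) := by
      intro p hp hmax
      by_contra! hlt
      have hnp : ∀ z ∈ Fᶜ.filter (fun z ↦ p < z), A (c z) (c p) ≤ 0 := by
        intro z hz
        simp only [Finset.mem_filter, Finset.mem_compl] at hz
        exact hA.nonpos _ _ fun h ↦ absurd (hmax z hz.1 h) (not_le.2 hz.2)
      have hq : (Finset.univ.filter fun z ↦ p < z ∧ c z = c p).Nonempty := by
        by_contra hne
        rw [Finset.not_nonempty_iff_eq_empty, Finset.filter_eq_empty_iff] at hne
        have h₁ := hM p (Finset.mem_univ _)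
        have : ∑ z with p < z, A (c z) (c p) ≤ ∑ j ∈ Fᶜ with p < j, A (c j) (c p) := by
          rw [← neg_le_neg_iff, ← Finset.sum_neg_distrib, ← Finset.sum_neg_distrib]
          refine Finset.sum_le_sum_of_subset_of_nonneg (fun z hz ↦ by simp_all) fun z hz _ ↦ ?_
          simp only [Finset.mem_filter, Finset.mem_univ, true_and] at hz
          exact neg_nonneg.2 (hA.nonpos _ _ fun h ↦ hne (Finset.mem_univ z) ⟨hz, h⟩)
        linarith [hn (c p)]
      obtain ⟨q, hq⟩ := Finset.exists_minimal hq
      have hq' := hq.prop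
      simp only [Finset.mem_filter, Finset.mem_univ, true_and] at hq'
      obtain ⟨hpq, hc⟩ := hq'
      have hmin : ∀ z, p < z → z < q → c z ≠ c p := fun z h₁ h₂ h₃ ↦
        absurd (hq.le_of_le (by simp [h₁, h₃]) h₂.le) (not_le.2 h₂)
      have hqF : q ∈ F := by
        by_contra hqF
        exact absurd (hmax q hqF hc) (not_le.2 hpq)
      refine hex ⟨p, q, hpq, hp, hqF, hc.symm, hmin, ?_⟩
      have h₂ := hM.sum_between hA hpq hc.symm
      rw [hc, ← Finset.sum_filter_add_sum_filter_not (Finset.univ.filter _) (· ∈ F)] at h₂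
      have h₃ : ∑ x ∈ (Finset.univ.filter fun z ↦ p < z ∧ z < q) with x ∉ F, A (c x) (c p) =
          ∑ j ∈ Fᶜ with p < j, A (c j) (c p) := by
        refine Finset.sum_subset (fun z hz ↦ by simp_all) fun z hz hz' ↦ ?_
        simp only [Finset.mem_filter, Finset.mem_univ, true_and, Finset.mem_compl] at hz hz'
        have hqz : q < z := by
          refine lt_of_le_of_ne (not_lt.1 fun h ↦ hz' ⟨⟨hz.2, h⟩, hz.1⟩) fun h ↦ hz.1 (h ▸ hqF)
        rw [← hc]
        exact hA.zero_symm _ _ (hM.pairing_eq_zero hA hF hqz hqF hz.1).2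
      have hnp' : ∀ z ∈ (Finset.univ.filter fun z ↦ p < z ∧ z < q).filter (· ∈ F),
          A (c z) (c p) ≤ 0 := by
        intro z hz
        simp only [Finset.mem_filter, Finset.mem_univ, true_and] at hz
        exact hA.nonpos _ _ (hmin z hz.1.1 hz.1.2)
      have h₄ : ∑ x ∈ (Finset.univ.filter fun z ↦ p < z ∧ z < q) with x ∈ F, A (c x) (c p) = 0 := by
        have := Finset.sum_nonpos hnp'
        omega
      rw [Finset.sum_eq_zero_iff_of_nonpos hnp'] at h₄
      intro u hu hpu huq
      exact h₄ u (by simp [hpu, huq, hu])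
    have hex' : ∀ i, ∃ m : ℤ, 0 ≤ m ∧ ∀ p, p ∉ F → c p = i → (∀ z, z ∉ F → c z = i → z ≤ p) →
        m - ∑ j ∈ Fᶜ with p < j, A (c j) i = 1 := by
      intro i
      by_cases h : ∃ p, p ∉ F ∧ c p = i ∧ ∀ z, z ∉ F → c z = i → z ≤ p
      · obtain ⟨p, hp, rfl, hmax⟩ := h
        refine ⟨_, key p hp hmax, fun r hr hcr hrmax ↦ ?_⟩
        obtain rfl : r = p := le_antisymm (hmax r hr hcr) (hrmax p hp rfl)
        ring
      -- A color absent from the complement imposes no condition.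
      · exact ⟨0, le_rfl, fun p hp hcp hmax ↦ absurd ⟨p, hp, hcp, hmax⟩ h⟩
    choose n' hn' hn'' using hex'
    refine ⟨n', hn', fun k hk ↦ ?_⟩
    have hk' : k ∉ F := by simpa using hk
    obtain ⟨p, hp⟩ := (Finset.univ.filter fun z ↦ z ∉ F ∧ c z = c k).exists_maximal
      ⟨k, by simp [hk']⟩
    have hp' := hp.prop
    simp only [Finset.mem_filter, Finset.mem_univ, true_and] at hp'
    have hmax : ∀ z, z ∉ F → c z = c k → z ≤ p := fun z hz hzk ↦ by
      rcases le_total z p with h | h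
      · exact h
      · exact hp.le_of_ge (by simp [hz, hzk]) h
    have h₁ := hn'' (c k) p hp'.1 hp'.2 hmax
    rcases (hmax k hk' rfl).eq_or_lt with rfl | hkp
    · exact h₁
    -- From `p` back to an earlier missing `k` of the same color the sum changes by 2 - 2 = 0.
    have h₂ := hM.sum_between hA hkp hp'.2.symm
    have h : ∑ z ∈ Fᶜ with k < z ∧ z < p, A (c z) (c p) =
        ∑ z with k < z ∧ z < p, A (c z) (c p) := by
      refine Finset.sum_subset (fun z hz ↦ by simp_all) fun z hz hz' ↦ ?_
      simp only [Finset.mem_filter, Finset.mem_univ, true_and, Finset.mem_compl] at hz hz'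
      exact (hM.pairing_eq_zero hA hF hz.2 (by_contra fun hzF ↦ hz' ⟨hzF, hz⟩) hp'.1).2
    rw [← h] at h₂
    rw [sum_filter_lt_split _ hkp (by simpa using hp'.1), hp'.2, hA.diag]
    rw [hp'.2] at h₂
    linarith

end Combinatorics

/-! ### Heaps of minuscule elements -/

section

variable {ι M N : Type*} [AddCommGroup M] [Module ℚ M] [AddCommGroup N] [Module ℚ N]
  {P : RootPairing ι ℚ M N} (b : P.Base) [P.IsCrystallographic]

/-- The entries `⟨α_i, α_j^∨⟩` of the Cartan matrix. -/
noncomputable def cartan (i j : b.support) : ℤ := P.pairingIn ℤ i j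

theorem cartan_cast (i j : b.support) : (cartan b i j : ℚ) = P.pairing i j :=
  P.algebraMap_pairingIn ℤ i j

theorem cartan_eq_zero_iff (i j : b.support) : cartan b i j = 0 ↔ P.pairing i j = 0 := by
  rw [← cartan_cast, Int.cast_eq_zero]

theorem isCartan [Finite ι] : IsCartan (cartan b) where
  diag i := P.pairingIn_same ℤ i
  nonpos i j h := b.pairingIn_le_zero_of_ne (fun h' ↦ h (Subtype.ext h')) i.2 j.2
  zero_symm i j h := by
    rw [cartan_eq_zero_iff] at h ⊢
    exact P.pairing_eq_zero_iff.1 h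

theorem commute_simpleReflection_iff (i j : b.support) :
    Commute (simpleReflection b i) (simpleReflection b j) ↔ ¬ (i ≠ j ∧ cartan b i j ≠ 0) := by
  rw [not_and, not_not]
  constructor
  · intro h hij
    -- Both products are applied to α_j; comparing the coefficients of α_i gives 2⟨α_j, α_i^∨⟩ = 0.
    have hx := congrArg (fun g ↦ g • P.root j) h.eq
    simp only [mul_smul, simpleReflection, ofIdx_smul_eq, root_coroot_eq_pairing, pairing_same,
      map_sub, map_smul, LinearMap.sub_apply, LinearMap.smul_apply, smul_eq_mul] at hx
    have hli := LinearIndependent.pair_iff.1 (b.linearIndependent_pair_of_ne hij)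
    have := (hli (2 * P.pairing j i) (-(P.pairing j i * P.pairing i j)) (by
        rw [← sub_eq_zero] at hx
        rw [← hx]
        module)).1
    rw [cartan_eq_zero_iff, P.pairing_eq_zero_iff]
    linarith
  · intro h
    by_cases hij : i = j
    · rw [hij]
    have h₁ := (cartan_eq_zero_iff b i j).1 (h hij)
    have h₂ := P.pairing_eq_zero_iff.1 h₁
    apply eq_of_forall_smul_eq
    intro x
    simp only [mul_smul, simpleReflection, ofIdx_smul_eq, root_coroot_eq_pairing,
      map_sub, map_smul, LinearMap.sub_apply, LinearMap.smul_apply, smul_eq_mul, h₁, h₂]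
    module

theorem dynkinAdj_iff (i j : b.support) : DynkinAdj b i j ↔ i ≠ j ∧ cartan b i j ≠ 0 := by
  rw [DynkinAdj, ne_eq (cartan b i j), cartan_eq_zero_iff]

variable {b} {ω : List b.support}

theorem Heap.gen_iff (p q : Heap b ω) : Heap.Gen p q ↔ (show Fin ω.length from p) < q ∧
    ω.get p ≠ ω.get q ∧ cartan b (ω.get p) (ω.get q) ≠ 0 :=
  and_congr_right fun _ ↦ (not_congr (commute_simpleReflection_iff b _ _)).trans not_not

omit [P.IsCrystallographic] in
theorem Heap.lt_of_gen {p q : Heap b ω} (h : Heap.Gen p q) : p < q := by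
  refine lt_of_le_of_ne (Relation.ReflTransGen.single h) ?_
  rintro rfl
  exact lt_irrefl _ h.1

omit [P.IsCrystallographic] in
theorem Heap.pos_lt_of_lt {p q : Heap b ω} (h : p < q) : (show Fin ω.length from p) < q :=
  lt_of_le_of_ne (Heap.le_of_gen h.le) h.ne

/-- A set of positions in the word `ω`, as a subset of its heap. -/
def Heap.ofFinset (b : P.Base) {ω : List b.support} (F : Finset (Fin ω.length)) :
    Set (Heap b ω) :=
  {k | (show Fin ω.length from k) ∈ F}

theorem isUpperSet_iff (F : Finset (Fin ω.length)) :
    IsUpperSet (Heap.ofFinset b F) ↔ AdjClosed (cartan b) ω.get F := by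
  constructor
  · intro h j k hjk hc hA hj
    exact h (Heap.lt_of_gen ((Heap.gen_iff (b := b) (ω := ω) j k).2 ⟨hjk, hc, hA⟩)).le hj
  · intro h p q hpq hp
    induction (show Relation.ReflTransGen Heap.Gen p q from hpq) with
    | refl => exact hp
    | tail _ hg ih =>
      obtain ⟨h₁, h₂, h₃⟩ := (Heap.gen_iff _ _).1 hg
      exact h _ _ h₁ h₂ h₃ (ih (by assumption))

theorem isMinusculeWord_subwordOf_mem_iff {π : M} {n : b.support → ℤ}
    (hn : ∀ i : b.support, P.toLinearMap π (P.coroot i) = n i) (S : Finset (Fin ω.length)) :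
    IsMinusculeWord b π (subwordOf ω (· ∈ S)) ↔ MinusculeOn (cartan b) ω.get n S := by
  rw [isMinusculeWord_subwordOf_iff]
  refine forall₂_congr fun k _ ↦ ?_
  rw [hn, ← Finset.filter_filter, Finset.filter_mem_eq_inter, Finset.univ_inter,
    ← Int.cast_inj (α := ℚ)]
  push_cast
  simp only [cartan_cast]

variable {π : M} {n : b.support → ℤ}
  (hn : ∀ i : b.support, P.toLinearMap π (P.coroot i) = n i) (hn₀ : ∀ i, 0 ≤ n i)
  (hM : MinusculeOn (cartan b) ω.get n Finset.univ)

include hn in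
theorem pairing_weight (F : Finset (Fin ω.length)) (i : b.support) :
    P.toLinearMap (π - ∑ k ∈ F, P.root (ω.get k)) (P.coroot i) =
      (n i - ∑ k ∈ F, cartan b (ω.get k) i : ℤ) := by
  rw [map_sub, LinearMap.sub_apply, hn, map_sum, LinearMap.sum_apply]
  push_cast
  simp only [cartan_cast, root_coroot_eq_pairing]

include hn hn₀ hM in
/-- The weights of the order filters of the heap are all the weights `σ π` for subwords `σ`. -/
theorem MinusculeOn.exists_filter_smul_eq [Finite ι] {σ : List b.support} (hσ : σ.Sublist ω) :
    ∃ F, AdjClosed (cartan b) ω.get F ∧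
      wordProd b σ • π = π - ∑ k ∈ F, P.root (ω.get k) := by
  classical
  -- Keeping `F` inside the positions from `m` on guarantees that the next letter read is missing
  -- from `F`, as `exists_insert` requires.
  suffices H : ∀ d m (σ : List b.support), m + d = ω.length → σ.Sublist (ω.drop m) →
      ∃ F, AdjClosed (cartan b) ω.get F ∧ (∀ k ∈ F, m ≤ (k : ℕ)) ∧
        wordProd b σ • π = π - ∑ k ∈ F, P.root (ω.get k) by
    obtain ⟨F, h₁, -, h₂⟩ := H ω.length 0 σ (by simp) (by simpa)
    exact ⟨F, h₁, h₂⟩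
  intro d
  induction d with
  | zero =>
    intro m σ hm hσ
    rw [List.drop_of_length_le (by omega), List.sublist_nil] at hσ
    subst hσ
    exact ⟨∅, fun j k _ _ _ h ↦ by simp at h, by simp, by simp [wordProd_nil]⟩
  | succ d ih =>
    intro m σ hm hσ
    have hmlt : m < ω.length := by omega
    rw [List.drop_eq_getElem_cons hmlt, List.sublist_cons_iff] at hσ
    rcases hσ with hσ | ⟨τ, rfl, hτ⟩
    · obtain ⟨F, h₁, h₂, h₃⟩ := ih (m + 1) σ (by omega) hσ
      exact ⟨F, h₁, fun k hk ↦ (Nat.le_succ m).trans (h₂ k hk), h₃⟩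
    · obtain ⟨F, h₁, h₂, h₃⟩ := ih (m + 1) τ (by omega) hτ
      have hmF : (⟨m, hmlt⟩ : Fin ω.length) ∉ F := fun h ↦ by
        have := h₂ _ h
        simp at this
      rw [wordProd_cons, mul_smul, h₃, simpleReflection, ofIdx_smul_eq, pairing_weight hn]
      change ∃ F', _ ∧ _ ∧ _ - ((n (ω.get ⟨m, hmlt⟩) - ∑ k ∈ F,
        cartan b (ω.get k) (ω.get ⟨m, hmlt⟩) : ℤ) : ℚ) • P.root (ω.get ⟨m, hmlt⟩) = _
      rcases lt_trichotomy (n (ω.get ⟨m, hmlt⟩) - ∑ k ∈ F,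
        cartan b (ω.get k) (ω.get ⟨m, hmlt⟩)) 0 with hneg | h0 | hpos
      · obtain ⟨r, hr, hc, hval, hcl⟩ := hM.exists_erase (isCartan b) h₁ (hn₀ _) hneg
        refine ⟨F.erase r, hcl,
          fun k hk ↦ (Nat.le_succ m).trans (h₂ k (Finset.mem_of_mem_erase hk)), ?_⟩
        rw [hval, ← Finset.add_sum_erase _ _ hr, hc]
        push_cast
        module
      · refine ⟨F, h₁, fun k hk ↦ (Nat.le_succ m).trans (h₂ k hk), ?_⟩
        rw [h0]
        simp
      · obtain ⟨q, hq, hqF, hc, hval, hcl⟩ := hM.exists_insert (isCartan b) h₁ hmF hpos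
        refine ⟨insert q F, hcl, fun k hk ↦ ?_, ?_⟩
        · rcases Finset.mem_insert.1 hk with rfl | hk
          · exact hq
          · exact (Nat.le_succ m).trans (h₂ k hk)
        · rw [hval, Finset.sum_insert hqF, hc]
          push_cast
          module

include hn in
theorem MinusculeOn.wordProd_smul_eq {F : Finset (Fin ω.length)}
    (hF : MinusculeOn (cartan b) ω.get n F) :
    wordProd b (subwordOf ω (· ∈ F)) • π = π - ∑ k ∈ F, P.root (ω.get k) := by
  rw [((isMinusculeWord_subwordOf_mem_iff hn F).2 hF).smul_eq, sum_map_subwordOf,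
    Finset.filter_mem_eq_inter, Finset.univ_inter]

variable [P.IsReduced] [Finite ι]

include hn hn₀ hM in
/-- An element of `W^π` below a minuscule element comes from an order filter of the heap. -/
theorem MinusculeOn.exists_isHeapOf (hπ : IsDominantIntegral b π) {v : P.weylGroup}
    (hv : IsMinCosetRep b π v) (hle : BruhatLE b v (wordProd b ω)) :
    ∃ Hv : Set (Heap b ω), Heap.IsHeapOf v Hv := by
  obtain ⟨σ, hσ, rfl⟩ := hle.exists_sublist rfl
  obtain ⟨F, hF, hw⟩ := hM.exists_filter_smul_eq hn hn₀ hσ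
  have hFM := hM.of_adjClosed (isCartan b) hF
  have hword := (isMinusculeWord_subwordOf_mem_iff hn F).2 hFM
  have heq : wordProd b σ = wordProd b (subwordOf ω (· ∈ F)) :=
    eq_of_smul_eq hπ (fun i hi h ↦ hv.pairing_ne_zero hi h)
      (fun i hi h ↦ by rw [hword.pairing_eq_one hi h]; norm_num)
      (hw.trans (hFM.wordProd_smul_eq hn).symm)
  exact ⟨Heap.ofFinset b F, (isUpperSet_iff F).2 hF, heq ▸ hword.isReducedWord hπ⟩

-- Equal elements give equal weights, and linear independence of the simple roots recovers the
-- number of letters of each color.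
omit [P.IsReduced] in
include hn hM in
theorem MinusculeOn.filter_eq_of_wordProd_eq [P.IsRootSystem] {F G : Finset (Fin ω.length)}
    (hF : AdjClosed (cartan b) ω.get F) (hG : AdjClosed (cartan b) ω.get G)
    (h : wordProd b (subwordOf ω (· ∈ F)) = wordProd b (subwordOf ω (· ∈ G))) : F = G := by
  classical
  have hsum : ∑ k ∈ F, P.root (ω.get k) = ∑ k ∈ G, P.root (ω.get k) := by
    have h₁ := (hM.of_adjClosed (isCartan b) hF).wordProd_smul_eq hn
    have h₂ := (hM.of_adjClosed (isCartan b) hG).wordProd_smul_eq hn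
    rw [h, h₂] at h₁
    exact (sub_right_injective h₁).symm
  have hcount : ∀ i, (F.filter fun k ↦ ω.get k = i).card = (G.filter fun k ↦ ω.get k = i).card := by
    have key : ∀ (S : Finset (Fin ω.length)) (i : b.support),
        b.toWeightBasis.coord i (∑ k ∈ S, P.root (ω.get k)) =
          ((S.filter fun k ↦ ω.get k = i).card : ℚ) := by
      intro S i
      rw [map_sum, Finset.card_filter]
      push_cast
      refine Finset.sum_congr rfl fun k _ ↦ ?_
      rw [Module.Basis.coord_apply, Base.toWeightBasis_repr_root, Finsupp.single_apply]
    intro i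
    have := congrArg (b.toWeightBasis.coord i) hsum
    rw [key, key] at this
    exact_mod_cast this
  exact Finset.Subset.antisymm
    (hM.subset_of_count_le (isCartan b) hF hG fun i ↦ (hcount i).le)
    (hM.subset_of_count_le (isCartan b) hG hF fun i ↦ (hcount i).ge)

-- The simple coroots form a basis, so the coordinates n' found combinatorially come from an actual
-- weight.
omit [P.IsCrystallographic] [P.IsReduced] [Finite ι] in
theorem exists_weight [P.IsRootSystem] (n : b.support → ℚ) :
    ∃ π : M, ∀ i : b.support, P.toLinearMap π (P.coroot i) = n i := by
  refine ⟨P.toPerfPair.symm (b.toCoweightBasis.constr ℚ n), fun i ↦ ?_⟩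
  rw [← LinearMap.toPerfPair_apply, LinearEquiv.apply_symm_apply, ← b.toCoweightBasis_apply i,
    Module.Basis.constr_basis]

omit [P.IsReduced] in
include hM in
theorem MinusculeOn.wordProd_compl_mul {F : Finset (Fin ω.length)}
    (hF : AdjClosed (cartan b) ω.get F) :
    wordProd b (subwordOf ω (· ∉ F)) * wordProd b (subwordOf ω (· ∈ F)) = wordProd b ω := by
  refine wordProd_subwordOf_mul ω (· ∈ F) fun j k hjk hj hk ↦ ?_
  rw [commute_simpleReflection_iff]
  exact fun h ↦ h.2 (hM.pairing_eq_zero (isCartan b) hF hjk hj hk).2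

include hM in
/-- The complement of an order filter `F` of the heap of `w` is minuscule for some dominant weight if
and only if `w v⁻¹` is, where `v` is the element with heap `F`. -/
theorem MinusculeOn.exists_isMinuscule_iff [P.IsRootSystem] {F : Finset (Fin ω.length)}
    (hF : AdjClosed (cartan b) ω.get F) (hω : IsReducedWord b ω (wordProd b ω))
    (hv : IsReducedWord b (subwordOf ω (· ∈ F)) (wordProd b (subwordOf ω (· ∈ F)))) :
    (∃ π' : M, IsDominantIntegral b π' ∧
      IsMinuscule b π' (wordProd b ω * (wordProd b (subwordOf ω (· ∈ F)))⁻¹)) ↔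
    ∃ n' : b.support → ℤ, (∀ i, 0 ≤ n' i) ∧ MinusculeOn (cartan b) ω.get n' Fᶜ := by
  have hmul := hM.wordProd_compl_mul hF
  -- The two subword lengths add up to ℓ(w), so subadditivity of length leaves no slack.
  have hred : IsReducedWord b (subwordOf ω (· ∉ F)) (wordProd b (subwordOf ω (· ∉ F))) := by
    refine ⟨rfl, le_antisymm ?_ (length_wordProd_le b _)⟩
    have h₁ := length_mul_le b (wordProd b (subwordOf ω (· ∉ F)))
      (wordProd b (subwordOf ω (· ∈ F)))
    have h₂ := length_subwordOf_add ω (· ∈ F)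
    have h₃ := hω.2
    have h₄ := hv.2
    rw [hmul] at h₁
    omega
  have hcompl : subwordOf ω (· ∉ F) = subwordOf ω (· ∈ Fᶜ) := by
    congr 1
    funext k
    simp
  rw [← hmul, mul_inv_cancel_right]
  simp only [hred.isMinuscule_iff]
  rw [hcompl]
  constructor
  · rintro ⟨π', hπ', hw⟩
    choose m hm using fun i : b.support ↦ hπ' i i.2
    exact ⟨fun i ↦ m i, fun i ↦ Int.natCast_nonneg _,
      (isMinusculeWord_subwordOf_mem_iff (by simpa using hm) _).1 hw⟩
  · rintro ⟨n', hn', hw⟩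
    obtain ⟨π', hπ'⟩ := exists_weight (b := b) fun i ↦ (n' i : ℚ)
    refine ⟨π', fun i hi ↦ ⟨(n' ⟨i, hi⟩).toNat, ?_⟩,
      (isMinusculeWord_subwordOf_mem_iff hπ' _).2 hw⟩
    rw [hπ' ⟨i, hi⟩, ← Int.cast_natCast, Int.toNat_of_nonneg (hn' _)]

end

/-! ### Excited diagrams -/

section

variable {Q I : Type*} [PartialOrder Q] {c : Q → I} {adj : I → I → Prop}

theorem ElementaryExcitation.ne {D D' : Set Q} (h : ElementaryExcitation c adj D D') : D' ≠ D := by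
  obtain ⟨p, q, hpq, hp, -, he, -⟩ := h
  rintro rfl
  have : p ∈ D' \ {q} := ⟨hp, hpq.ne⟩
  rw [he] at this
  exact this.2 rfl

/-- An elementary excitation always changes the set, so only the absence of a first step matters. -/
theorem ncard_excitedDiagrams_eq_one_iff (F : Set Q) :
    (excitedDiagrams c adj F).ncard = 1 ↔ ∀ D, ¬ ElementaryExcitation c adj F D := by
  have hF : F ∈ excitedDiagrams c adj F := Relation.ReflTransGen.refl
  rw [Set.ncard_eq_one]
  constructor
  · rintro ⟨X, hX⟩ D hD
    have h₁ : D ∈ excitedDiagrams c adj F := Relation.ReflTransGen.single hD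
    rw [hX] at hF h₁
    exact hD.ne (h₁.trans hF.symm)
  · intro h
    refine ⟨F, Set.eq_singleton_iff_unique_mem.2 ⟨hF, fun D hD ↦ ?_⟩⟩
    rcases Relation.ReflTransGen.cases_head hD with h' | ⟨E, hE, -⟩
    · exact h'.symm
    · exact absurd hE (h E)

theorem exists_elementaryExcitation_iff (F : Set Q) :
    (∃ D, ElementaryExcitation c adj F D) ↔
      ∃ p q, p < q ∧ p ∉ F ∧ q ∈ F ∧ c p = c q ∧ (∀ z, p < z → z < q → c z ≠ c p) ∧
        ∀ u ∈ F ∩ Set.Icc p q, ¬ adj (c p) (c u) := by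
  constructor
  · rintro ⟨D, p, q, hpq, hp, hq, he, hc, hz, hu⟩
    refine ⟨p, q, hpq, fun hpF ↦ ?_, hq, hc, hz, hu⟩
    have : p ∈ F \ {q} := ⟨hpF, hpq.ne⟩
    rw [he] at this
    exact this.2 rfl
  · rintro ⟨p, q, hpq, hp, hq, hc, hz, hu⟩
    refine ⟨insert p (F \ {q}), p, q, hpq, Set.mem_insert _ _, hq, ?_, hc, hz, hu⟩
    ext x
    constructor
    · exact fun hx ↦ ⟨Or.inr hx, fun h ↦ hp (h ▸ hx.1)⟩
    · rintro ⟨rfl | hx, h⟩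
      · exact absurd rfl h
      · exact hx

end

section

variable {ι M N : Type*} [AddCommGroup M] [Module ℚ M] [AddCommGroup N] [Module ℚ N]
  {P : RootPairing ι ℚ M N} {b : P.Base} [P.IsCrystallographic] [Finite ι] {ω : List b.support}
  {n : b.support → ℤ}

theorem MinusculeOn.heap_lt_iff (hM : MinusculeOn (cartan b) ω.get n Finset.univ)
    {p q : Heap b ω} (hc : p.color = q.color) :
    p < q ↔ (show Fin ω.length from p) < q := by
  refine ⟨Heap.pos_lt_of_lt, fun h ↦ ?_⟩
  obtain ⟨z, h₁, h₂, h₃, h₄⟩ := hM.exists_adj_between (isCartan b) h hc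
  have hc' : ω.get p = ω.get q := hc
  refine (Heap.lt_of_gen ((Heap.gen_iff (b := b) (ω := ω) p z).2 ⟨h₁, ?_, ?_⟩)).trans
    (Heap.lt_of_gen ((Heap.gen_iff (b := b) (ω := ω) z q).2 ⟨h₂, h₃, h₄⟩))
  · rw [hc']
    exact h₃.symm
  · rw [hc']
    exact fun h ↦ h₄ ((isCartan b).zero_symm _ _ h)

/-- Heap order can be replaced by word order: equal colors compare alike in both, and a letter
adjacent to c(p) = c(q) placed between `p` and `q` in the word is between them in the heap. -/
theorem MinusculeOn.exists_elementaryExcitation_iff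
    (hM : MinusculeOn (cartan b) ω.get n Finset.univ) (F : Finset (Fin ω.length)) :
    (∃ D, ElementaryExcitation (Heap.color (ω := ω)) (DynkinAdj b) (Heap.ofFinset b F) D) ↔
      ∃ p q, p < q ∧ p ∉ F ∧ q ∈ F ∧ ω.get p = ω.get q ∧
        (∀ z, p < z → z < q → ω.get z ≠ ω.get p) ∧
        ∀ u ∈ F, p < u → u < q → cartan b (ω.get u) (ω.get p) = 0 := by
  rw [WeylHeap.exists_elementaryExcitation_iff]
  constructor
  · rintro ⟨p, q, hpq, hp, hq, hc, hz, hu⟩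
    have hz' : ∀ z : Heap b ω, (show Fin ω.length from p) < z → (show Fin ω.length from z) < q →
        z.color ≠ p.color := fun z h₁ h₂ h ↦
      hz z ((hM.heap_lt_iff h.symm).2 h₁) ((hM.heap_lt_iff (h.trans hc)).2 h₂) h
    refine ⟨p, q, Heap.pos_lt_of_lt hpq, hp, hq, hc, hz', fun u huF h₁ h₂ ↦ ?_⟩
    by_contra hA
    have hne : ω.get u ≠ ω.get p := hz' u h₁ h₂
    have hA' : cartan b (ω.get p) (ω.get u) ≠ 0 := fun h ↦ hA ((isCartan b).zero_symm _ _ h)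
    have hc' : ω.get p = ω.get q := hc
    refine hu u ⟨huF, (Heap.lt_of_gen ((Heap.gen_iff (b := b) (ω := ω) p u).2
      ⟨h₁, hne.symm, hA'⟩)).le, (Heap.lt_of_gen ((Heap.gen_iff (b := b) (ω := ω) u q).2
      ⟨h₂, by rwa [← hc'], by rwa [← hc']⟩)).le⟩ ?_
    exact (dynkinAdj_iff b _ _).2 ⟨hne.symm, hA'⟩
  · rintro ⟨p, q, hpq, hp, hq, hc, hz, hu⟩
    refine ⟨p, q, (hM.heap_lt_iff hc).2 hpq, hp, hq, hc,
      fun z h₁ h₂ ↦ hz z (Heap.pos_lt_of_lt h₁) (Heap.pos_lt_of_lt h₂), fun u hu' hadj ↦ ?_⟩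
    obtain ⟨huF, h₁, h₂⟩ := hu'
    obtain ⟨hne, hA⟩ := (dynkinAdj_iff b _ _).1 hadj
    have hup : p ≠ u := by rintro rfl; exact hne rfl
    have huq : u ≠ q := by rintro rfl; exact hne hc
    refine hA ((isCartan b).zero_symm _ _ (hu u huF ?_ ?_))
    · exact Heap.pos_lt_of_lt (lt_of_le_of_ne (α := Heap b ω) h₁ hup)
    · exact Heap.pos_lt_of_lt (lt_of_le_of_ne (α := Heap b ω) h₂ huq)

end

end WeylHeap

/-! ### Assembly of the theorem. -/

theorem mainTheorem9 {ι M N : Type*} [Finite ι] [AddCommGroup M] [Module ℚ M]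
    [AddCommGroup N] [Module ℚ N] (P : RootPairing ι ℚ M N) [P.IsRootSystem]
    [P.IsCrystallographic] [P.IsReduced] (b : P.Base)
    (π : M) (hπ : WeylHeap.IsDominantIntegral b π)
    (w : P.weylGroup) (hw : WeylHeap.IsMinuscule b π w)
    (v : P.weylGroup) (hv : v ∈ WeylHeap.bruhatInterval b π 1 w)
    (ω : List b.support) (hω : WeylHeap.IsReducedWord b ω w) :
    (∃! Hv : Set (WeylHeap.Heap b ω), WeylHeap.Heap.IsHeapOf v Hv) ∧
    ∀ Hv : Set (WeylHeap.Heap b ω), WeylHeap.Heap.IsHeapOf v Hv →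
      ((WeylHeap.excitedDiagrams (WeylHeap.Heap.color (ω := ω))
          (WeylHeap.DynkinAdj b) Hv).ncard = 1 ↔
        ∃ π' : M, WeylHeap.IsDominantIntegral b π' ∧
          WeylHeap.IsMinuscule b π' (w * v⁻¹)) := by
  classical
  choose m hm using fun i : b.support ↦ hπ i i.2
  have hn : ∀ i : b.support, P.toLinearMap π (P.coroot i) = ((m i : ℤ) : ℚ) := by simpa using hm
  have hn₀ : ∀ i, 0 ≤ (m i : ℤ) := fun i ↦ Int.natCast_nonneg _
  have hM : WeylHeap.MinusculeOn (WeylHeap.cartan b) ω.get (fun i ↦ (m i : ℤ)) Finset.univ := by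
    rw [← WeylHeap.isMinusculeWord_subwordOf_mem_iff hn]
    simpa [WeylHeap.subwordOf_true] using hω.isMinuscule_iff.1 hw
  obtain ⟨rfl, hl⟩ := hω
  have hfin : ∀ Hv : Set (WeylHeap.Heap b ω), ∃ F : Finset (Fin ω.length), 
      Hv = WeylHeap.Heap.ofFinset b F := fun Hv ↦
    ⟨(Finset.univ : Finset (Fin ω.length)).filter fun k ↦ (show WeylHeap.Heap b ω from k) ∈ Hv,
      Set.ext fun k ↦ (Finset.mem_filter_univ
        (p := fun k : Fin ω.length ↦ (show WeylHeap.Heap b ω from k) ∈ Hv) k).symm⟩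
  refine ⟨existsUnique_of_exists_of_unique
    (hM.exists_isHeapOf hn hn₀ hπ hv.1 hv.2.2) fun H₁ H₂ h₁ h₂ ↦ ?_, fun Hv hHv ↦ ?_⟩
  · obtain ⟨F, rfl⟩ := hfin H₁
    obtain ⟨G, rfl⟩ := hfin H₂
    rw [hM.filter_eq_of_wordProd_eq hn ((WeylHeap.isUpperSet_iff F).1 h₁.1)
      ((WeylHeap.isUpperSet_iff G).1 h₂.1) (h₁.2.1.trans h₂.2.1.symm)]
  · obtain ⟨F, rfl⟩ := hfin Hv
    obtain ⟨hup, hvF⟩ := hHv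
    have hF := (WeylHeap.isUpperSet_iff F).1 hup
    have hvF' : WeylHeap.IsReducedWord b (WeylHeap.subwordOf ω (· ∈ F)) v := hvF
    obtain ⟨rfl, hlv⟩ := hvF'
    rw [WeylHeap.ncard_excitedDiagrams_eq_one_iff,
      hM.exists_isMinuscule_iff hF ⟨rfl, hl⟩ ⟨rfl, hlv⟩,
      hM.exists_compl_iff (WeylHeap.isCartan b) hn₀ hF, ← hM.exists_elementaryExcitation_iff,
      not_exists]
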